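/- Fix a real number $\xi \ge 0$, and let $(a_n)_{n\ge 0}$ be a sequence of real numbers. Then the following are equivalent: (a) $(a_n)$ is a $\xi$-Stieltjes moment sequence, i.e. there exists a positive measure $\mu$ on $\mathbb{R}$, with support in $[\xi,\infty)$, such that $a_n = \int x^n \, d\mu(x)$ for all $n \ge 0$ (in particular all these integrals converge absolutely). (b) There exist real numbers $c \ge 0$, $g_0 = 0$ and $g_1, g_2, \ldots \ge 0$ such that, in the sense of formal power series in $t$, $$\sum_{n=0}^\infty a_n t^n \;=\; \cfrac{c}{1 - \cfrac{\alpha_1 t}{1 - \cfrac{\alpha_2 t}{1 - \cdots}}}$$ (the finite truncations of the continued fraction converge coefficientwise to the left-hand side), where for all $k \ge 1$ $$\alpha_{2k-1} \;=\; \xi\,(1+g_{2k-2}) + g_{2k-1}, \qquad \alpha_{2k} \;=\; \frac{g_{2k-1}\, g_{2k}}{1+g_{2k-2}}.$$ (c) Same as (b), but with $g_0 \ge 0$ in place of $g_0 = 0$. -/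

import Mathlib

open PowerSeries MeasureTheory

noncomputable section

/-- `a` is a `ξ`-Stieltjes moment sequence: there is a positive Borel measure `μ` with support
in `[ξ, ∞)`, having finite moments of all orders, such that `a n = ∫ x ^ n dμ(x)` for all `n`. -/
def IsXiStieltjes (ξ : ℝ) (a : ℕ → ℝ) : Prop :=
  ∃ μ : Measure ℝ, μ.support ⊆ Set.Ici ξ ∧
    ∀ n : ℕ, Integrable (fun x : ℝ => x ^ n) μ ∧ a n = ∫ x, x ^ n ∂μ

/-- The finite continued fraction `1 / (1 - α i t / (1 - α (i+1) t / ⋯ / (1 - α (i+n-1) t)))`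
with `n` coefficients, starting at the index `i`, as a formal power series. Every denominator has
constant term `1`, so that `⁻¹` is the inverse of an invertible power series. -/
def sFracConvergent (α : ℕ → ℝ) : ℕ → ℕ → ℝ⟦X⟧
  | 0, _ => 1
  | n + 1, i => (1 - PowerSeries.C (α i) * PowerSeries.X * sFracConvergent α n (i + 1))⁻¹

/-- `f(t) = c / (1 - α 1 t / (1 - α 2 t / (1 - ⋯)))` in the sense of formal power series: the
finite truncations of the continued fraction converge to `f` coefficientwise, that is, each
coefficient is eventually equal to that of `f`. The value `α 0` plays no role. -/
def IsSFraction (f : ℝ⟦X⟧) (c : ℝ) (α : ℕ → ℝ) : Prop :=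
  ∀ m : ℕ, ∀ᶠ n in Filter.atTop,
    PowerSeries.coeff m (PowerSeries.C c * sFracConvergent α n 1) = PowerSeries.coeff m f

/-- The relations `α_{2k-1} = ξ (1 + g_{2k-2}) + g_{2k-1}` and
`α_{2k} = g_{2k-1} g_{2k} / (1 + g_{2k-2})` for all `k ≥ 1` (with `k + 1` written for `k`). -/
def XiCoefficients (ξ : ℝ) (g α : ℕ → ℝ) : Prop :=
  ∀ k : ℕ, α (2 * k + 1) = ξ * (1 + g (2 * k)) + g (2 * k + 1) ∧
    α (2 * k + 2) = g (2 * k + 1) * g (2 * k + 2) / (1 + g (2 * k))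

end

/-! Translating a measure by `ξ` replaces its moment series `f(t)` by
`f(t / (1 - ξ t)) / (1 - ξ t)`, and this adds `ξ` to every linear coefficient of a J-fraction.
After even contraction, the relations between `α` and `g` with `g 0 = 0` say exactly that the
S-fraction `α` is the translate by `ξ` of the S-fraction with coefficients
`β (2k-1) = g (2k-1)` and `β (2k) = α (2k-1) g (2k) / (1 + g (2k-2))`. This reduces the
equivalence with `g 0 = 0` to Stieltjes' theorem, the case `ξ = 0`.

If `f = 1 / (1 - t h)`, a triangular change of basis (by Toeplitz polynomials) carries the Hankel
form of `h` to the shifted Hankel form of `f`, and vice versa, so that positivity passes from `f` to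
`h` and the coefficients peeled off the moment series of a measure on `[0, ∞)` are nonnegative.
Conversely, each convergent with nonnegative coefficients has the form `⟨v, (1 - t DᵀD)⁻¹ v⟩`, so by
the spectral theorem it is the moment series of a finitely supported measure on `[0, ∞)`, and a
weak limit point of these measures has the moments of the infinite fraction.

Finally, for fixed `α` the values `g (2k)` depend monotonically on `g 0`, so a nonnegative solution
with `g 0 ≥ 0` yields one with `g 0 = 0`: its even-indexed values decrease, its odd-indexed values
increase, and all of them stay nonnegative. -/

section ContinuedFraction

variable {R : Type*} [CommRing R]

/-- The equations `F i = 1 / (d i - t v i F (i + 1))` between the successive tails `F i` of a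
continued fraction, written without division. They cover S-fractions (`d i = 1`, `v i` constant)
and J-fractions (`d i = 1 - γ i t`, `v i = δ i t`). -/
def IsFractionTails (d v F : ℕ → R⟦X⟧) : Prop :=
  ∀ i, F i * (d i - X * v i * F (i + 1)) = 1

lemma eq_of_forall_X_pow_dvd_sub {f g : R⟦X⟧} (h : ∀ n, X ^ n ∣ f - g) : f = g := by
  rw [← sub_eq_zero]
  ext m
  simpa using X_pow_dvd_iff.1 (h (m + 1)) m m.lt_succ_self

lemma X_pow_succ_dvd_sub_of_mul_eq_one {d v f f' p p' : R⟦X⟧} {n : ℕ}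
    (hf : f * (d - X * v * p) = 1) (hf' : f' * (d - X * v * p') = 1) (h : X ^ n ∣ p - p') :
    X ^ (n + 1) ∣ f - f' := by
  have hsub : f - f' = X * (p - p') * (v * f * f') := by
    linear_combination f' * hf - f * hf'
  rw [hsub, pow_succ']
  exact (mul_dvd_mul_left X h).mul_right _

lemma IsFractionTails.eq {d v F F' : ℕ → R⟦X⟧} (hF : IsFractionTails d v F)
    (hF' : IsFractionTails d v F') (i : ℕ) : F i = F' i := by
  refine eq_of_forall_X_pow_dvd_sub fun n => ?_
  induction n generalizing i with
  | zero => simp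
  | succ n ih => exact X_pow_succ_dvd_sub_of_mul_eq_one (hF i) (hF' i) (ih (i + 1))

/-- The coefficients of `t` in the denominators of the even contraction of the S-fraction with
coefficients `α 1, α 2, …`. -/
def contractionDiag (α : ℕ → R) : ℕ → R
  | 0 => α 1
  | j + 1 => α (2 * j + 2) + α (2 * j + 3)

/-- The tails of the even contraction of the S-fraction with tails `F 1, F 2, …`. -/
noncomputable def contractionTail (F : ℕ → R⟦X⟧) : ℕ → R⟦X⟧
  | 0 => F 1
  | j + 1 => F (2 * j + 2) * F (2 * j + 3)

lemma IsFractionTails.contraction {α : ℕ → R} {F : ℕ → R⟦X⟧}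
    (hF : IsFractionTails (fun _ => 1) (fun i => C (α i)) F) :
    IsFractionTails (fun j => 1 - C (contractionDiag α j) * X)
      (fun j => C (α (2 * j + 1) * α (2 * j + 2)) * X) (contractionTail F) := by
  rintro (_ | j)
  · have h1 := hF 1
    have h2 := hF 2
    simp only [contractionTail, contractionDiag, map_mul, mul_zero, zero_add]
    linear_combination h1 + C (α 1) * X * F 1 * h2
  · have h2 := hF (2 * j + 2)
    have h3 := hF (2 * j + 3)
    have h4 := hF (2 * j + 4)
    simp only [contractionTail, contractionDiag, map_mul, map_add, mul_add_one, add_assoc,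
      Nat.reduceAdd] at *
    linear_combination F (2 * j + 2) * h3 + h2
      + C (α (2 * j + 3)) * X * F (2 * j + 2) * F (2 * j + 3) * h4

end ContinuedFraction

section SFraction

variable (α : ℕ → ℝ)

lemma constantCoeff_sFracConvergent (n i : ℕ) :
    constantCoeff (sFracConvergent α n i) = 1 := by
  cases n <;> simp [sFracConvergent]

lemma sFracConvergent_succ_mul (n i : ℕ) :
    sFracConvergent α (n + 1) i * (1 - X * C (α i) * sFracConvergent α n (i + 1)) = 1 := by
  rw [sFracConvergent, X_mul]
  exact PowerSeries.inv_mul_cancel _ (by simp)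

lemma X_pow_dvd_sFracConvergent_succ_sub (n i : ℕ) :
    X ^ (n + 1) ∣ sFracConvergent α (n + 1) i - sFracConvergent α n i := by
  induction n generalizing i with
  | zero =>
    refine ⟨C (α i) * sFracConvergent α 1 i, ?_⟩
    have h := sFracConvergent_succ_mul α 0 i
    simp only [sFracConvergent.eq_1, zero_add, pow_one] at h ⊢
    linear_combination h
  | succ n ih =>
    exact X_pow_succ_dvd_sub_of_mul_eq_one (sFracConvergent_succ_mul α _ i)
      (sFracConvergent_succ_mul α _ i) (ih (i + 1))

/-- The infinite continued fraction `1 / (1 - α i t / (1 - α (i + 1) t / ⋯))`. Its `m`-th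
coefficient is read off the `m`-th convergent, where it has become stationary. -/
noncomputable def sFraction (i : ℕ) : ℝ⟦X⟧ :=
  mk fun m => coeff m (sFracConvergent α m i)

lemma coeff_sFracConvergent {m n : ℕ} (h : m ≤ n) (i : ℕ) :
    coeff m (sFracConvergent α n i) = coeff m (sFraction α i) := by
  induction n, h using Nat.le_induction with
  | base => rw [sFraction, coeff_mk]
  | succ n hn ih =>
    have hsub := X_pow_dvd_iff.1 (X_pow_dvd_sFracConvergent_succ_sub α n i) m (by lia)
    rw [map_sub, sub_eq_zero] at hsub
    rw [hsub, ih]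

lemma X_pow_dvd_sFraction_sub (n i : ℕ) : X ^ n ∣ sFraction α i - sFracConvergent α n i := by
  refine X_pow_dvd_iff.2 fun m hm => ?_
  rw [map_sub, coeff_sFracConvergent α hm.le, sub_self]

lemma isFractionTails_sFraction :
    IsFractionTails (fun _ => 1) (fun i => C (α i)) (sFraction α) := by
  refine fun i => eq_of_forall_X_pow_dvd_sub fun n => ?_
  have hden : X ^ n ∣ (1 - X * C (α i) * sFraction α (i + 1)) -
      (1 - X * C (α i) * sFracConvergent α n (i + 1)) := by
    rw [sub_sub_sub_cancel_left, ← mul_sub]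
    exact (dvd_sub_comm.1 (X_pow_dvd_sFraction_sub α n (i + 1))).mul_left _
  have hprod := dvd_mul_sub_mul
    ((pow_dvd_pow X n.le_succ).trans (X_pow_dvd_sFraction_sub α (n + 1) i)) hden
  rwa [sFracConvergent_succ_mul] at hprod

variable {α}

lemma isSFraction_iff {f : ℝ⟦X⟧} {c : ℝ} : IsSFraction f c α ↔ f = C c * sFraction α 1 := by
  constructor
  · intro h
    ext m
    obtain ⟨n, hn, hmn⟩ := ((h m).and (Filter.eventually_ge_atTop m)).exists
    rw [← hn, coeff_C_mul, coeff_C_mul, coeff_sFracConvergent α hmn]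
  · rintro rfl m
    filter_upwards [Filter.eventually_ge_atTop m] with n hn
    rw [coeff_C_mul, coeff_C_mul, coeff_sFracConvergent α hn]

end SFraction

section MomentFunctional

variable {R : Type*} [CommRing R]

lemma constr_basisMonomials_X_pow {M : Type*} [AddCommMonoid M] [Module R M] (u : ℕ → M) (n : ℕ) :
    (Polynomial.basisMonomials R).constr R u (Polynomial.X ^ n) = u n := by
  simpa only [Polynomial.coe_basisMonomials, Polynomial.monomial_one_right_eq_X_pow] using
    (Polynomial.basisMonomials R).constr_basis R u n

/-- The linear functional on polynomials whose moments are the coefficients of `f`. -/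
noncomputable def momentFunctional (f : R⟦X⟧) : Polynomial R →ₗ[R] R :=
  (Polynomial.basisMonomials R).constr R fun n => coeff n f

@[simp] lemma momentFunctional_X_pow (f : R⟦X⟧) (n : ℕ) :
    momentFunctional f (Polynomial.X ^ n) = coeff n f :=
  constr_basisMonomials_X_pow _ n

@[simp] lemma momentFunctional_one (f : R⟦X⟧) : momentFunctional f 1 = constantCoeff f := by
  simpa only [pow_zero, coeff_zero_eq_constantCoeff_apply] using momentFunctional_X_pow f 0

lemma momentFunctional_C_add_X_mul (r : R) (f : R⟦X⟧) (p : Polynomial R) :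
    momentFunctional (C r + X * f) (Polynomial.X * p) = momentFunctional f p := by
  induction p using Polynomial.induction_on' with
  | add p q hp hq => rw [mul_add, map_add, map_add, hp, hq]
  | monomial n a =>
    rw [← Polynomial.smul_X_eq_monomial, mul_smul_comm, ← pow_succ', map_smul, map_smul,
      momentFunctional_X_pow, momentFunctional_X_pow, map_add, coeff_succ_X_mul, coeff_succ_C,
      zero_add]

lemma exists_eq_C_add_X_mul (f : R⟦X⟧) : ∃ f', f = C (constantCoeff f) + X * f' :=
  ⟨_, f.eq_X_mul_shift_add_const.trans (add_comm _ _)⟩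

end MomentFunctional

section BinomialTransform

variable {K : Type*} [Field K] (ξ : K)

lemma hasSubst_X_mul_inv : HasSubst (X * (1 - C ξ * X : K⟦X⟧)⁻¹) :=
  HasSubst.of_constantCoeff_zero' (by simp)

/-- The map `f(t) ↦ f(t / (1 - ξ t)) / (1 - ξ t)`. It takes the generating function of the moments
`∫ xⁿ` to that of the translated moments `∫ (x + ξ)ⁿ`. -/
noncomputable def binomialTransform : K⟦X⟧ →ₗ[K] K⟦X⟧ :=
  LinearMap.mulLeft K (1 - C ξ * X)⁻¹ ∘ₗ (substAlgHom (hasSubst_X_mul_inv ξ)).toLinearMap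

lemma binomialTransform_apply (f : K⟦X⟧) :
    binomialTransform ξ f = (1 - C ξ * X)⁻¹ * substAlgHom (hasSubst_X_mul_inv ξ) f := rfl

variable {ξ} in
lemma substAlgHom_C {g : K⟦X⟧} (hg : HasSubst g) (r : K) : substAlgHom (R := K) hg (C r) = C r :=
  (substAlgHom hg).commutes r

lemma one_sub_C_mul_X_mul_inv : (1 - C ξ * X : K⟦X⟧) * (1 - C ξ * X)⁻¹ = 1 :=
  PowerSeries.mul_inv_cancel _ (by simp)

lemma IsFractionTails.binomialTransform {γ δ : ℕ → K} {F : ℕ → K⟦X⟧}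
    (hF : IsFractionTails (fun j => 1 - C (γ j) * X) (fun j => C (δ j) * X) F) :
    IsFractionTails (fun j => 1 - C (γ j + ξ) * X) (fun j => C (δ j) * X)
      (fun j => binomialTransform ξ (F j)) := by
  intro j
  have hinv := one_sub_C_mul_X_mul_inv ξ
  have hsubst := congrArg (substAlgHom (hasSubst_X_mul_inv ξ)) (hF j)
  simp only [map_mul, map_sub, map_one, substAlgHom_C, substAlgHom_X] at hsubst
  simp only [binomialTransform_apply, map_add]
  linear_combination hsubst + substAlgHom (hasSubst_X_mul_inv ξ) (F j) * hinv

lemma binomialTransform_C_add_X_mul (r : K) (f : K⟦X⟧) :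
    binomialTransform ξ (C r + X * f) =
      C r + X * (C ξ * binomialTransform ξ (C r + X * f) + binomialTransform ξ f) := by
  have hinv := one_sub_C_mul_X_mul_inv ξ
  simp only [binomialTransform_apply, map_add, map_mul, substAlgHom_C, substAlgHom_X]
  linear_combination
    (C r + X * (1 - C ξ * X)⁻¹ * substAlgHom (hasSubst_X_mul_inv ξ) f) * hinv

lemma coeff_binomialTransform (f : K⟦X⟧) (n : ℕ) :
    coeff n (binomialTransform ξ f) =
      momentFunctional f ((Polynomial.X + Polynomial.C ξ) ^ n) := by
  induction n generalizing f with
  | zero =>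
    obtain ⟨f', hf⟩ := exists_eq_C_add_X_mul f
    rw [pow_zero, momentFunctional_one, hf, binomialTransform_C_add_X_mul]
    simp
  | succ n ih =>
    obtain ⟨f', hf⟩ := exists_eq_C_add_X_mul f
    rw [pow_succ', add_mul, map_add, ← Polynomial.smul_eq_C_mul, map_smul, ← ih f]
    nth_rw 1 2 [hf]
    rw [momentFunctional_C_add_X_mul, ← ih f', binomialTransform_C_add_X_mul, ← hf, map_add,
      coeff_succ_C, coeff_succ_X_mul, map_add, coeff_C_mul, smul_eq_mul]
    ring

lemma momentFunctional_binomialTransform (f : K⟦X⟧) (p : Polynomial K) :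
    momentFunctional (binomialTransform ξ f) p =
      momentFunctional f (p.comp (Polynomial.X + Polynomial.C ξ)) := by
  induction p using Polynomial.induction_on' with
  | add p q hp hq => rw [Polynomial.add_comp, map_add, map_add, hp, hq]
  | monomial n a =>
    rw [← Polynomial.smul_X_eq_monomial, Polynomial.smul_comp, Polynomial.X_pow_comp, map_smul,
      map_smul, momentFunctional_X_pow, coeff_binomialTransform]

lemma binomialTransform_binomialTransform_neg (f : K⟦X⟧) :
    binomialTransform ξ (binomialTransform (-ξ) f) = f := by
  ext n
  rw [coeff_binomialTransform, momentFunctional_binomialTransform]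
  simp

end BinomialTransform

section Toeplitz

variable {R : Type*} [CommRing R]

/-- The Toeplitz polynomials of `h`, normalised so that `f * (1 - X * h) = 1` makes them orthogonal
to `1` for `momentFunctional f`. -/
noncomputable def toeplitzPoly (h : R⟦X⟧) : ℕ → Polynomial R
  | 0 => 1
  | j + 1 => Polynomial.X * toeplitzPoly h j - Polynomial.C (coeff j h)

lemma momentFunctional_toeplitzPoly (f h : R⟦X⟧) (j : ℕ) :
    momentFunctional f (toeplitzPoly h j) = coeff j (f * (1 - X * h)) := by
  induction j generalizing f with
  | zero => simp [toeplitzPoly]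
  | succ j ih =>
    obtain ⟨f', hf⟩ := exists_eq_C_add_X_mul f
    have hmul : f * (1 - X * h) =
        C (constantCoeff f) + X * (f' * (1 - X * h) - C (constantCoeff f) * h) := by
      linear_combination (1 - X * h) * hf
    rw [toeplitzPoly, map_sub, hmul, map_add, coeff_succ_C, coeff_succ_X_mul, map_sub, ← ih f',
      coeff_C_mul, ← mul_one (Polynomial.C _), ← Polynomial.smul_eq_C_mul, map_smul,
      momentFunctional_one]
    nth_rw 1 [hf]
    rw [momentFunctional_C_add_X_mul, smul_eq_mul]
    ring

/-- The linear map sending `X ^ j` to the `j`-th Toeplitz polynomial of `h`. -/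
noncomputable def toeplitzMap (h : R⟦X⟧) : Polynomial R →ₗ[R] Polynomial R :=
  (Polynomial.basisMonomials R).constr R (toeplitzPoly h)

lemma toeplitzMap_X_pow (h : R⟦X⟧) (j : ℕ) :
    toeplitzMap h (Polynomial.X ^ j) = toeplitzPoly h j :=
  constr_basisMonomials_X_pow _ j

lemma toeplitzMap_one (h : R⟦X⟧) : toeplitzMap h 1 = 1 := by
  simpa only [pow_zero, toeplitzPoly] using toeplitzMap_X_pow h 0

lemma toeplitzMap_X_mul (h : R⟦X⟧) (p : Polynomial R) :
    toeplitzMap h (Polynomial.X * p) =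
      Polynomial.X * toeplitzMap h p - Polynomial.C (momentFunctional h p) := by
  induction p using Polynomial.induction_on' with
  | add p q hp hq =>
    simp only [mul_add, map_add, hp, hq]
    ring
  | monomial n a =>
    rw [← Polynomial.smul_X_eq_monomial, mul_smul_comm, ← pow_succ']
    simp only [map_smul, toeplitzMap_X_pow, toeplitzPoly, momentFunctional_X_pow]
    rw [smul_sub, mul_smul_comm, Polynomial.smul_C]

variable {f h : R⟦X⟧} (hfh : f * (1 - X * h) = 1)

include hfh

lemma momentFunctional_toeplitzMap (p : Polynomial R) :
    momentFunctional f (toeplitzMap h p) = p.coeff 0 := by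
  induction p using Polynomial.induction_on' with
  | add p q hp hq => rw [map_add, map_add, hp, hq, Polynomial.coeff_add]
  | monomial n a =>
    rw [← Polynomial.smul_X_eq_monomial, map_smul, map_smul, toeplitzMap_X_pow,
      momentFunctional_toeplitzPoly, hfh, Polynomial.coeff_smul, Polynomial.coeff_X_pow, coeff_one]
    simp only [eq_comm]

lemma momentFunctional_X_mul_toeplitzMap (p : Polynomial R) :
    momentFunctional f (Polynomial.X * toeplitzMap h p) = momentFunctional h p := by
  have hf0 : constantCoeff f = 1 := by simpa using congrArg constantCoeff hfh
  have hsplit := toeplitzMap_X_mul h p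
  rw [eq_sub_iff_add_eq, ← mul_one (Polynomial.C _), ← Polynomial.smul_eq_C_mul] at hsplit
  rw [← hsplit, map_add, momentFunctional_toeplitzMap hfh, Polynomial.coeff_X_mul_zero, map_smul,
    momentFunctional_one, hf0, smul_eq_mul, mul_one, zero_add]

lemma momentFunctional_X_mul_toeplitzMap_X_mul_mul (p q : Polynomial R) :
    momentFunctional f (Polynomial.X * (toeplitzMap h (Polynomial.X * p) * toeplitzMap h q)) =
      momentFunctional f (Polynomial.X * (toeplitzMap h p * toeplitzMap h (Polynomial.X * q))) := by
  have hcomm : Polynomial.X * (toeplitzMap h (Polynomial.X * p) * toeplitzMap h q) =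
      Polynomial.X * (toeplitzMap h p * toeplitzMap h (Polynomial.X * q)) +
        (momentFunctional h q • (Polynomial.X * toeplitzMap h p) -
          momentFunctional h p • (Polynomial.X * toeplitzMap h q)) := by
    simp only [toeplitzMap_X_mul, Polynomial.smul_eq_C_mul]
    ring
  rw [hcomm, map_add, map_sub, map_smul, map_smul, momentFunctional_X_mul_toeplitzMap hfh,
    momentFunctional_X_mul_toeplitzMap hfh, smul_eq_mul, smul_eq_mul,
    mul_comm (momentFunctional h q), sub_self, add_zero]

lemma momentFunctional_X_mul_toeplitzMap_mul (p q : Polynomial R) :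
    momentFunctional f (Polynomial.X * (toeplitzMap h p * toeplitzMap h q)) =
      momentFunctional h (p * q) := by
  induction p using Polynomial.induction_on' with
  | add p p' hp hp' => simp only [map_add, add_mul, mul_add, hp, hp']
  | monomial n a =>
    rw [← Polynomial.smul_X_eq_monomial, map_smul]
    simp only [smul_mul_assoc, mul_smul_comm, map_smul]
    congr 1
    induction n generalizing q with
    | zero =>
      rw [pow_zero, toeplitzMap_one, one_mul, one_mul, momentFunctional_X_mul_toeplitzMap hfh]
    | succ n ih =>
      rw [pow_succ', momentFunctional_X_mul_toeplitzMap_X_mul_mul hfh, ih, mul_left_comm,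
        mul_assoc]

lemma momentFunctional_toeplitzMap_X_mul_mul (p q : Polynomial R) :
    momentFunctional f (toeplitzMap h (Polynomial.X * p) * toeplitzMap h (Polynomial.X * q)) =
      momentFunctional h (Polynomial.X * (p * q)) := by
  rw [toeplitzMap_X_mul h p, sub_mul, map_sub, mul_assoc,
    momentFunctional_X_mul_toeplitzMap_mul hfh, ← Polynomial.smul_eq_C_mul, map_smul,
    momentFunctional_toeplitzMap hfh, Polynomial.coeff_X_mul_zero, smul_zero, sub_zero,
    mul_left_comm]

end Toeplitz

section HankelPositivity

variable {R : Type*} [CommRing R] [PartialOrder R] {f h : R⟦X⟧}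

/-- The Hankel forms of the coefficient sequence of `f` and of the shifted sequence are positive
semidefinite. -/
def IsHankelPos (f : R⟦X⟧) : Prop :=
  ∀ p : Polynomial R, 0 ≤ momentFunctional f (p * p) ∧
    0 ≤ momentFunctional f (Polynomial.X * (p * p))

lemma IsHankelPos.smul [IsOrderedRing R] (hf : IsHankelPos f) {c : R} (hc : 0 ≤ c) :
    IsHankelPos (c • f) := by
  have hsmul : momentFunctional (c • f) = c • momentFunctional f :=
    (Polynomial.basisMonomials R).ext fun n => by
      simp only [Polynomial.coe_basisMonomials, Polynomial.monomial_one_right_eq_X_pow,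
        LinearMap.smul_apply, momentFunctional_X_pow, map_smul]
  intro p
  rw [hsmul]
  exact ⟨mul_nonneg hc (hf p).1, mul_nonneg hc (hf p).2⟩

lemma IsHankelPos.constantCoeff_nonneg (hf : IsHankelPos f) : 0 ≤ constantCoeff f := by
  simpa using (hf 1).1

lemma IsHankelPos.of_inv (hf : IsHankelPos f) (hfh : f * (1 - X * h) = 1) : IsHankelPos h := by
  intro p
  rw [← momentFunctional_X_mul_toeplitzMap_mul hfh, ← momentFunctional_toeplitzMap_X_mul_mul hfh]
  exact ⟨(hf _).2, (hf _).1⟩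

variable {K : Type*} [Field K] [LinearOrder K] [IsStrictOrderedRing K] {f : K⟦X⟧}

lemma IsHankelPos.eq_zero (hf : IsHankelPos f) (h0 : constantCoeff f = 0) : f = 0 := by
  have hquad : ∀ (n : ℕ) (s : K), 0 ≤ coeff (n + n) f + 2 * s * coeff n f := by
    intro n s
    have hsq : (Polynomial.X ^ n + Polynomial.C s) * (Polynomial.X ^ n + Polynomial.C s) =
        Polynomial.X ^ (n + n) + (2 * s) • Polynomial.X ^ n + (s * s) • 1 := by
      simp only [Polynomial.smul_eq_C_mul, Polynomial.C_mul, pow_add, Polynomial.C_ofNat]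
      ring
    have hpos := (hf (Polynomial.X ^ n + Polynomial.C s)).1
    simpa only [hsq, map_add, map_smul, momentFunctional_X_pow, momentFunctional_one, h0,
      smul_eq_mul, mul_zero, add_zero] using hpos
  ext n
  by_contra hn
  rw [map_zero] at hn
  have hneg := hquad n (-(coeff (n + n) f + 1) / (2 * coeff n f))
  field_simp at hneg
  linarith

lemma IsHankelPos.exists_next (hf : IsHankelPos f) :
    ∃ h, IsHankelPos h ∧ f * (1 - X * h) = C (constantCoeff f) ∧
      (constantCoeff f = 0 → constantCoeff h = 0) := by
  rcases eq_or_ne (constantCoeff f) 0 with h0 | h0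
  · obtain rfl := hf.eq_zero h0
    exact ⟨0, hf, by simp, fun _ => map_zero _⟩
  · set g : K⟦X⟧ := (constantCoeff f)⁻¹ • f with hg
    have hg0 : constantCoeff g = 1 := by simp [hg, h0]
    obtain ⟨h, hh⟩ : X ∣ 1 - g⁻¹ := X_dvd_iff.2 (by simp [hg0])
    have hgh : g * (1 - X * h) = 1 := by
      rw [← hh, sub_sub_cancel]
      exact PowerSeries.mul_inv_cancel _ (by simp [hg0])
    refine ⟨h, (hf.smul (inv_nonneg.2 hf.constantCoeff_nonneg)).of_inv hgh, ?_,
      fun h => absurd h h0⟩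
    have hfg : f = C (constantCoeff f) * g := by
      rw [hg, ← smul_eq_C_mul, smul_inv_smul₀ h0]
    nth_rw 1 [hfg]
    rw [mul_assoc, hgh, mul_one]

lemma IsHankelPos.exists_isFractionTails (hf : IsHankelPos f) :
    ∃ (β : ℕ → K) (G : ℕ → K⟦X⟧), (∀ i, 0 ≤ β i) ∧ (∀ i, β i = 0 → β (i + 1) = 0) ∧
      IsFractionTails (fun _ => 1) (fun i => C (β i)) G ∧ f = C (β 0) * G 1 := by
  choose! next hpos hnext hzero using fun (f : K⟦X⟧) (hf : IsHankelPos f) => hf.exists_next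
  have hiter : ∀ i, IsHankelPos (next^[i] f) := fun i =>
    Function.Iterate.rec IsHankelPos hf hpos i
  set G : ℕ → K⟦X⟧ := fun i => (1 - X * next^[i] f)⁻¹
  have hG : ∀ i, G i * (1 - X * next^[i] f) = 1 := fun i =>
    PowerSeries.inv_mul_cancel _ (by simp)
  have hfG : ∀ i, next^[i] f = C (constantCoeff (next^[i] f)) * G (i + 1) := by
    intro i
    have hstep := hnext _ (hiter i)
    rw [← Function.iterate_succ_apply' next] at hstep
    linear_combination G (i + 1) * hstep - next^[i] f * hG (i + 1)
  refine ⟨fun i => constantCoeff (next^[i] f), G, fun i => (hiter i).constantCoeff_nonneg,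
    fun i h => ?_, fun i => ?_, hfG 0⟩
  · simpa only [Function.iterate_succ_apply'] using hzero _ (hiter i) h
  · rw [mul_assoc, ← hfG i, hG i]

end HankelPositivity

section Moments

variable {μ : Measure ℝ} {f g : ℝ⟦X⟧}

/-- The measure `μ` has finite moments of all orders, with generating function `f`. -/
def HasMomentSeries (μ : Measure ℝ) (f : ℝ⟦X⟧) : Prop :=
  ∀ n, Integrable (fun x => x ^ n) μ ∧ coeff n f = ∫ x, x ^ n ∂μ

lemma hasMomentSeries_dirac (x : ℝ) : HasMomentSeries (Measure.dirac x) (mk fun n => x ^ n) :=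
  fun n => ⟨integrable_dirac (by simp), by rw [coeff_mk, integral_dirac]⟩

lemma HasMomentSeries.smul (h : HasMomentSeries μ f) {c : ℝ} (hc : 0 ≤ c) :
    HasMomentSeries (ENNReal.ofReal c • μ) (c • f) := fun n =>
  ⟨(h n).1.smul_measure ENNReal.ofReal_ne_top, by
    rw [map_smul, integral_smul_measure, ENNReal.toReal_ofReal hc, (h n).2]⟩

lemma HasMomentSeries.sum {ι : Type*} {s : Finset ι} {μ : ι → Measure ℝ} {f : ι → ℝ⟦X⟧}
    (h : ∀ i ∈ s, HasMomentSeries (μ i) (f i)) :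
    HasMomentSeries (∑ i ∈ s, μ i) (∑ i ∈ s, f i) := fun n =>
  ⟨integrable_finsetSum_measure.2 fun i hi => (h i hi n).1, by
    rw [integral_finsetSum_measure fun i hi => (h i hi n).1, map_sum]
    exact Finset.sum_congr rfl fun i hi => (h i hi n).2⟩

lemma HasMomentSeries.measureReal_univ (h : HasMomentSeries μ f) :
    μ.real Set.univ = constantCoeff f := by
  simpa using (h 0).2.symm

lemma HasMomentSeries.integrable_eval (h : HasMomentSeries μ f) (p : Polynomial ℝ) :
    Integrable (fun x => p.eval x) μ := by
  induction p using Polynomial.induction_on' with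
  | add p q hp hq =>
    simp only [Polynomial.eval_add]
    exact hp.add hq
  | monomial n a => simpa only [Polynomial.eval_monomial] using (h n).1.const_mul a

lemma HasMomentSeries.momentFunctional_eq (h : HasMomentSeries μ f) (p : Polynomial ℝ) :
    momentFunctional f p = ∫ x, p.eval x ∂μ := by
  induction p using Polynomial.induction_on' with
  | add p q hp hq =>
    simp only [Polynomial.eval_add, map_add, hp, hq]
    exact (integral_add (h.integrable_eval p) (h.integrable_eval q)).symm
  | monomial n a =>
    rw [← Polynomial.smul_X_eq_monomial, map_smul, momentFunctional_X_pow, (h n).2, smul_eq_mul,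
      ← integral_const_mul]
    simp only [Polynomial.eval_smul, Polynomial.eval_pow, Polynomial.eval_X, smul_eq_mul]

lemma HasMomentSeries.isHankelPos (h : HasMomentSeries μ f) (hμ : ∀ᵐ x ∂μ, 0 ≤ x) :
    IsHankelPos f := by
  intro p
  simp only [h.momentFunctional_eq, Polynomial.eval_mul, Polynomial.eval_X]
  refine ⟨integral_nonneg fun x => mul_self_nonneg _, integral_nonneg_of_ae ?_⟩
  filter_upwards [hμ] with x hx
  exact mul_nonneg hx (mul_self_nonneg _)

lemma HasMomentSeries.map_add_const (h : HasMomentSeries μ f) (ξ : ℝ) :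
    HasMomentSeries (μ.map (· + ξ)) (binomialTransform ξ f) := by
  have heval : ∀ (n : ℕ) (x : ℝ),
      ((Polynomial.X + Polynomial.C ξ) ^ n).eval x = (x + ξ) ^ n := by simp
  have hemb := measurableEmbedding_addRight ξ
  refine fun n => ⟨hemb.integrable_map_iff.2 ?_, ?_⟩
  · exact (h.integrable_eval ((Polynomial.X + Polynomial.C ξ) ^ n)).congr
      (.of_forall (heval n))
  · rw [hemb.integral_map, coeff_binomialTransform, h.momentFunctional_eq]
    simp only [heval]

/-- The coefficients of `f` are the moments of a positive measure on `[ξ, ∞)`. -/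
def IsStieltjesSeries (ξ : ℝ) (f : ℝ⟦X⟧) : Prop :=
  ∃ μ : Measure ℝ, (∀ᵐ x ∂μ, ξ ≤ x) ∧ HasMomentSeries μ f

lemma support_subset_Ici_iff {ξ : ℝ} : μ.support ⊆ Set.Ici ξ ↔ ∀ᵐ x ∂μ, ξ ≤ x :=
  ⟨fun h => Filter.mem_of_superset Measure.support_mem_ae h,
    fun h => Measure.support_subset_of_isClosed isClosed_Ici h⟩

lemma isXiStieltjes_iff {ξ : ℝ} {a : ℕ → ℝ} :
    IsXiStieltjes ξ a ↔ IsStieltjesSeries ξ (mk a) := by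
  simp only [IsXiStieltjes, IsStieltjesSeries, HasMomentSeries, support_subset_Ici_iff, coeff_mk]

lemma IsStieltjesSeries.binomialTransform {η : ℝ} (h : IsStieltjesSeries η f) (ξ : ℝ) :
    IsStieltjesSeries (η + ξ) (binomialTransform ξ f) := by
  obtain ⟨μ, hμ, hf⟩ := h
  refine ⟨μ.map (· + ξ), ?_, hf.map_add_const ξ⟩
  rw [(measurableEmbedding_addRight ξ).ae_map_iff]
  filter_upwards [hμ] with x hx
  gcongr

lemma isStieltjesSeries_iff_exists {ξ : ℝ} :
    IsStieltjesSeries ξ f ↔ ∃ g, IsStieltjesSeries 0 g ∧ f = binomialTransform ξ g := by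
  constructor
  · intro h
    refine ⟨binomialTransform (-ξ) f, ?_, (binomialTransform_binomialTransform_neg ξ f).symm⟩
    simpa only [add_neg_cancel] using h.binomialTransform (-ξ)
  · rintro ⟨g, hg, rfl⟩
    simpa only [zero_add] using hg.binomialTransform ξ

lemma IsStieltjesSeries.smul {ξ : ℝ} (h : IsStieltjesSeries ξ f) {c : ℝ} (hc : 0 ≤ c) :
    IsStieltjesSeries ξ (c • f) := by
  obtain ⟨μ, hμ, hf⟩ := h
  exact ⟨ENNReal.ofReal c • μ, Measure.ae_smul_measure hμ _, hf.smul hc⟩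

lemma IsStieltjesSeries.exists_sFraction (h : IsStieltjesSeries 0 f) :
    ∃ (c : ℝ) (β : ℕ → ℝ), 0 ≤ c ∧ (∀ i, 0 ≤ β i) ∧ (∀ i, β i = 0 → β (i + 1) = 0) ∧
      f = c • sFraction β 1 := by
  obtain ⟨μ, hμ, hf⟩ := h
  obtain ⟨β, G, hβ, hzero, hG, rfl⟩ := (hf.isHankelPos hμ).exists_isFractionTails
  exact ⟨β 0, β, hβ 0, hβ, hzero, by
    rw [hG.eq (isFractionTails_sFraction β), smul_eq_C_mul]⟩

end Moments

section Gram

open Matrix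

/-- `f = ⟨v, (1 - t DᵀD)⁻¹ v⟩` for some matrix `D` and vector `v`; the vector of power series `y`
stands for `(1 - t DᵀD)⁻¹ v`. -/
def IsGramSeries {R : Type*} [CommRing R] (f : R⟦X⟧) : Prop :=
  ∃ (ι κ : Type) (_ : Fintype ι) (_ : Fintype κ) (D : Matrix κ ι R) (v : ι → R) (y : ι → R⟦X⟧),
    y = C ∘ v + (X : R⟦X⟧) • (Dᵀ.map C *ᵥ (D.map C *ᵥ y)) ∧ f = (C ∘ v) ⬝ᵥ y

variable {R : Type*} [CommRing R]

lemma isGramSeries_one : IsGramSeries (1 : R⟦X⟧) :=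
  ⟨Unit, Unit, inferInstance, inferInstance, 0, 1, 1, by ext; simp, by simp [dotProduct]⟩

lemma IsGramSeries.sq_mul {f : R⟦X⟧} (hf : IsGramSeries f) (s : R) :
    IsGramSeries (C (s ^ 2) * f) := by
  obtain ⟨ι, κ, _, _, D, v, y, hy, rfl⟩ := hf
  have hv : C ∘ (s • v) = (C s : R⟦X⟧) • (C ∘ v) := by ext; simp
  refine ⟨ι, κ, inferInstance, inferInstance, D, s • v, (C s : R⟦X⟧) • y, ?_, ?_⟩
  · rw [hv, mulVec_smul, mulVec_smul, smul_comm X, ← smul_add, ← hy]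
  · rw [hv, smul_dotProduct, dotProduct_smul, map_pow, smul_eq_mul, smul_eq_mul, sq, mul_assoc]

-- The resolvent of `EᵀE` for `E = [v | Dᵀ]` is expressed by that of `DᵀD`, because `EEᵀ - DᵀD` is
-- the rank-one matrix `vvᵀ`.
lemma IsGramSeries.of_inv {f g : R⟦X⟧} (hf : IsGramSeries f) (hgf : g * (1 - X * f) = 1) :
    IsGramSeries g := by
  obtain ⟨ι, κ, _, _, D, v, y, hy, rfl⟩ := hf
  set E : Matrix ι (Unit ⊕ κ) R := fromCols (replicateCol Unit v) Dᵀ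
  set Y : Unit ⊕ κ → R⟦X⟧ := Sum.elim (fun _ => g) ((X * g) • (D.map C *ᵥ y)) with hY
  have hEY : E.map C *ᵥ Y = g • y := by
    conv_rhs => rw [hy]
    rw [fromCols_map, hY, fromCols_mulVec_sumElim, mulVec_smul, smul_add, mul_comm, mul_smul]
    congr 1
    ext1 i
    simp [mulVec, dotProduct, mul_comm]
  refine ⟨Unit ⊕ κ, ι, inferInstance, inferInstance, E, Sum.elim 1 0, Y, ?_, ?_⟩
  · rw [hEY, transpose_fromCols, fromRows_map, fromRows_mulVec, mulVec_smul, mulVec_smul]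
    ext1 (i | k)
    · have hg : g = 1 + X * (g * (C ∘ v) ⬝ᵥ y) := by linear_combination hgf
      simpa [hY, mulVec, dotProduct, transpose_map] using hg
    · simp [hY, mul_assoc]
  · simp [hY, dotProduct]

section Coefficients

variable {ι κ : Type*} [Fintype ι]

lemma coeff_map_C_mulVec (M : Matrix κ ι R) (y : ι → R⟦X⟧) (n : ℕ) (k : κ) :
    coeff n ((M.map C *ᵥ y) k) = (M *ᵥ fun i => coeff n (y i)) k := by
  simp only [mulVec, dotProduct, map_sum, map_apply, coeff_C_mul]

lemma coeff_resolvent [Fintype κ] [DecidableEq ι] {D : Matrix κ ι R} {v : ι → R} {y : ι → R⟦X⟧}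
    (hy : y = C ∘ v + (X : R⟦X⟧) • (Dᵀ.map C *ᵥ (D.map C *ᵥ y))) (n : ℕ) :
    (fun i => coeff n (y i)) = (Dᵀ * D) ^ n *ᵥ v := by
  induction n with
  | zero =>
    rw [hy]
    ext i
    simp
  | succ n ih =>
    ext i
    have hyi := congrArg (coeff (n + 1)) (congrFun hy i)
    rw [hyi, pow_succ', ← mulVec_mulVec, ← ih]
    simp [coeff_map_C_mulVec, coeff_succ_X_mul, coeff_succ_C, ← mulVec_mulVec]

lemma dotProduct_pow_mulVec_eq_sum [DecidableEq ι] {A : Matrix ι ι ℝ} (hA : A.IsHermitian)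
    (v : ι → ℝ) (n : ℕ) :
    v ⬝ᵥ (A ^ n *ᵥ v) =
      ∑ j, (v ⬝ᵥ (hA.eigenvectorBasis j).ofLp) ^ 2 * hA.eigenvalues j ^ n := by
  have hpow : ∀ j, A ^ n *ᵥ (hA.eigenvectorBasis j).ofLp =
      hA.eigenvalues j ^ n • (hA.eigenvectorBasis j).ofLp := by
    intro j
    induction n with
    | zero => simp
    | succ n ih =>
      rw [pow_succ, ← mulVec_mulVec, hA.mulVec_eigenvectorBasis, mulVec_smul, ih, smul_smul,
        pow_succ']
  have hparseval := hA.eigenvectorBasis.sum_inner_mul_inner (WithLp.toLp 2 v)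
    (WithLp.toLp 2 (A ^ n *ᵥ v))
  have hT : (A ^ n)ᵀ = A ^ n := by
    rw [← conjTranspose_eq_transpose_of_trivial]
    exact (hA.pow n).eq
  simp only [EuclideanSpace.inner_eq_star_dotProduct, star_trivial] at hparseval
  rw [dotProduct_comm, ← hparseval]
  refine Finset.sum_congr rfl fun j _ => ?_
  rw [dotProduct_comm (A ^ n *ᵥ v), dotProduct_mulVec, ← mulVec_transpose, hT, hpow,
    smul_dotProduct, dotProduct_comm _ v, smul_eq_mul]
  ring

end Coefficients

lemma IsGramSeries.isStieltjesSeries {f : ℝ⟦X⟧} (hf : IsGramSeries f) :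
    IsStieltjesSeries 0 f := by
  classical
  obtain ⟨ι, κ, _, _, D, v, y, hy, rfl⟩ := hf
  have hA : (Dᵀ * D).PosSemidef := by
    simpa only [conjTranspose_eq_transpose_of_trivial] using posSemidef_conjTranspose_mul_self D
  set w : ι → ℝ := fun j => (v ⬝ᵥ (hA.1.eigenvectorBasis j).ofLp) ^ 2
  refine ⟨∑ j, ENNReal.ofReal (w j) • Measure.dirac (hA.1.eigenvalues j), ?_, ?_⟩
  · refine ae_finsetSum_measure_iff.2 fun j _ => Measure.ae_smul_measure ?_ _
    simpa using hA.eigenvalues_nonneg j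
  · have hf : (C ∘ v) ⬝ᵥ y = ∑ j, w j • mk fun n => hA.1.eigenvalues j ^ n := by
      ext n
      have hcoeff : coeff n ((C ∘ v) ⬝ᵥ y) = v ⬝ᵥ fun i => coeff n (y i) := by
        simp only [dotProduct, map_sum, Function.comp_apply, coeff_C_mul]
      rw [hcoeff, coeff_resolvent hy, dotProduct_pow_mulVec_eq_sum hA.1]
      simp [w]
    rw [hf]
    exact .sum fun j _ => (hasMomentSeries_dirac _).smul (sq_nonneg _)

lemma isGramSeries_sFracConvergent {β : ℕ → ℝ} (hβ : ∀ i, 0 ≤ β i) (n i : ℕ) :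
    IsGramSeries (sFracConvergent β n i) := by
  induction n generalizing i with
  | zero => exact isGramSeries_one
  | succ n ih =>
    refine ((ih (i + 1)).sq_mul √(β i)).of_inv ?_
    rw [Real.sq_sqrt (hβ i), ← mul_assoc, sFracConvergent_succ_mul]

end Gram

section WeakLimits

open Filter Topology
open scoped ENNReal

lemma isTightMeasureSet_of_lintegral_enorm_pow_le {E : Type*} [NormedAddCommGroup E]
    [ProperSpace E] [MeasurableSpace E] [OpensMeasurableSpace E] {S : Set (Measure E)} {p : ℕ}
    (hp : p ≠ 0) {M : ℝ≥0∞} (hM : M ≠ ⊤) (h : ∀ μ ∈ S, ∫⁻ x, ‖x‖ₑ ^ p ∂μ ≤ M) :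
    IsTightMeasureSet S := by
  have hlim : Tendsto (fun r : ℝ => M / ENNReal.ofReal r ^ p) atTop (𝓝 0) := by
    have htop : Tendsto (fun r : ℝ => ENNReal.ofReal r ^ p) atTop (𝓝 ⊤) := by
      simpa only [ENNReal.top_pow hp, Function.comp_def] using
        ((ENNReal.continuous_pow p).tendsto ⊤).comp ENNReal.tendsto_ofReal_atTop
    simpa only [ENNReal.div_top] using ENNReal.Tendsto.const_div htop (.inr hM)
  refine isTightMeasureSet_of_tendsto_measure_norm_gt <|
    tendsto_of_tendsto_of_tendsto_of_le_of_le' tendsto_const_nhds hlim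
      (.of_forall fun _ => zero_le) ?_
  filter_upwards [eventually_gt_atTop 0] with r hr
  refine iSup₂_le fun μ hμ => ?_
  calc μ {x | r < ‖x‖}
      ≤ μ {x | ENNReal.ofReal r ^ p ≤ ‖x‖ₑ ^ p} := by
        refine measure_mono fun x (hx : r < ‖x‖) => ?_
        have hle : ENNReal.ofReal r ≤ ‖x‖ₑ := by
          rw [← ofReal_norm]
          exact ENNReal.ofReal_le_ofReal hx.le
        exact pow_le_pow_left₀ zero_le hle p
    _ ≤ (∫⁻ x, ‖x‖ₑ ^ p ∂μ) / ENNReal.ofReal r ^ p :=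
        meas_ge_le_lintegral_div (by fun_prop)
          (pow_ne_zero p (ENNReal.ofReal_pos.2 hr).ne') (ENNReal.pow_ne_top ENNReal.ofReal_ne_top)
    _ ≤ M / ENNReal.ofReal r ^ p := ENNReal.div_le_div_right (h μ hμ) _

lemma abs_sub_truncation_le {R : ℝ} (hR : 0 < R) (y : ℝ) :
    |y - max (-R) (min R y)| ≤ y ^ 2 / R := by
  rw [le_div_iff₀ hR]
  rcases le_total y R with h | h
  · rw [min_eq_right h]
    rcases le_total (-R) y with h' | h'
    · rw [max_eq_right h', sub_self, abs_zero, zero_mul]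
      positivity
    · rw [max_eq_left h', abs_of_nonpos (by linarith)]
      nlinarith
  · rw [min_eq_left h, max_eq_right (by linarith), abs_of_nonneg (by linarith)]
    nlinarith

lemma abs_truncation_le {R : ℝ} (hR : 0 ≤ R) (y : ℝ) : |max (-R) (min R y)| ≤ R :=
  abs_le.2 ⟨le_max_left _ _, max_le (by linarith) (min_le_left _ _)⟩

lemma abs_integral_sub_integral_truncation_le {Ω : Type*} [MeasurableSpace Ω] {μ : Measure Ω}
    [IsFiniteMeasure μ] {f : Ω → ℝ} (hf : MemLp f 2 μ) {R : ℝ} (hR : 0 < R) :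
    |∫ x, f x ∂μ - ∫ x, max (-R) (min R (f x)) ∂μ| ≤ (∫ x, f x ^ 2 ∂μ) / R := by
  have hint : Integrable (fun x => max (-R) (min R (f x))) μ :=
    .of_bound (aestronglyMeasurable_const.sup (aestronglyMeasurable_const.inf hf.1)) R
      (.of_forall fun x => abs_truncation_le hR.le (f x))
  have hf1 : Integrable f μ := hf.integrable one_le_two
  rw [← integral_sub hf1 hint, ← integral_div]
  exact (abs_integral_le_integral_abs).trans <|
    integral_mono (hf1.sub hint).abs (hf.integrable_sq.div_const R)
      fun x => abs_sub_truncation_le hR (f x)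

variable {Ω : Type*} [MeasurableSpace Ω] [TopologicalSpace Ω] [OpensMeasurableSpace Ω]
  {P : ℕ → ProbabilityMeasure Ω} {ν : ProbabilityMeasure Ω} {f : Ω → ℝ} {M : ℝ}

lemma tendsto_integral_truncation (hP : Tendsto P atTop (𝓝 ν)) (hf : Continuous f) {R : ℝ}
    (hR : 0 ≤ R) :
    Tendsto (fun n => ∫ x, max (-R) (min R (f x)) ∂(P n : Measure Ω)) atTop
      (𝓝 (∫ x, max (-R) (min R (f x)) ∂(ν : Measure Ω))) :=
  ProbabilityMeasure.tendsto_iff_forall_integral_tendsto.1 hP <|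
    BoundedContinuousFunction.ofNormedAddCommGroup (fun x => max (-R) (min R (f x)))
      (by fun_prop) R fun x => abs_truncation_le hR (f x)

variable [HasOuterApproxClosed Ω]

lemma ae_mem_of_tendsto_of_isClosed (hP : Tendsto P atTop (𝓝 ν)) {s : Set Ω} (hs : IsClosed s)
    (h : ∀ n, ∀ᵐ x ∂(P n : Measure Ω), x ∈ s) : ∀ᵐ x ∂(ν : Measure Ω), x ∈ s := by
  have hzero : ∀ n, (P n : Measure Ω) sᶜ = 0 := fun n => ae_iff.1 (h n)
  have hle := ProbabilityMeasure.le_liminf_measure_open_of_tendsto hP hs.isOpen_compl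
  simp only [hzero, liminf_const] at hle
  exact ae_iff.2 (le_antisymm hle zero_le)

lemma lintegral_ofReal_le_of_tendsto (hP : Tendsto P atTop (𝓝 ν)) (hf : Continuous f)
    (hf0 : 0 ≤ f) (hint : ∀ n, Integrable f (P n : Measure Ω))
    (hM : ∀ n, ∫ x, f x ∂(P n : Measure Ω) ≤ M) :
    ∫⁻ x, ENNReal.ofReal (f x) ∂(ν : Measure Ω) ≤ ENNReal.ofReal M := by
  have hle := lintegral_le_liminf_lintegral_of_forall_isOpen_measure_le_liminf_measure hf hf0
    fun G hG => ProbabilityMeasure.le_liminf_measure_open_of_tendsto hP hG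
  simp only [← ofReal_integral_eq_lintegral_ofReal (hint _) (.of_forall hf0)] at hle
  refine hle.trans ((liminf_le_liminf (.of_forall fun n => ?_)).trans (liminf_const _).le)
  exact ENNReal.ofReal_le_ofReal (hM n)

lemma memLp_two_of_tendsto (hP : Tendsto P atTop (𝓝 ν)) (hf : Continuous f)
    (hint : ∀ n, MemLp f 2 (P n : Measure Ω))
    (hM : ∀ n, ∫ x, f x ^ 2 ∂(P n : Measure Ω) ≤ M) :
    MemLp f 2 (ν : Measure Ω) ∧ ∫ x, f x ^ 2 ∂(ν : Measure Ω) ≤ M := by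
  have hle := lintegral_ofReal_le_of_tendsto hP (hf.pow 2) (fun x => sq_nonneg (f x))
    (fun n => (hint n).integrable_sq) hM
  have hM0 : 0 ≤ M := (integral_nonneg fun x => sq_nonneg (f x)).trans (hM 0)
  have hint' : Integrable (fun x => f x ^ 2) (ν : Measure Ω) :=
    (lintegral_ofReal_ne_top_iff_integrable (hf.pow 2).aestronglyMeasurable
      (.of_forall fun x => sq_nonneg (f x))).1 (hle.trans_lt ENNReal.ofReal_lt_top).ne
  refine ⟨(memLp_two_iff_integrable_sq hf.aestronglyMeasurable).2 hint', ?_⟩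
  exact (ENNReal.ofReal_le_ofReal_iff hM0).1 <|
    (ofReal_integral_eq_lintegral_ofReal hint' (.of_forall fun x => sq_nonneg (f x))).trans_le hle

-- The second-moment bound makes the truncations at height `R` converge uniformly in `n`.
lemma tendsto_integral_of_integral_sq_le (hP : Tendsto P atTop (𝓝 ν)) (hf : Continuous f)
    (hint : ∀ n, MemLp f 2 (P n : Measure Ω))
    (hM : ∀ n, ∫ x, f x ^ 2 ∂(P n : Measure Ω) ≤ M) :
    Tendsto (fun n => ∫ x, f x ∂(P n : Measure Ω)) atTop (𝓝 (∫ x, f x ∂(ν : Measure Ω))) := by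
  have hν := memLp_two_of_tendsto hP hf hint hM
  have hMR : Tendsto (fun R : ℝ => M / R) atTop (𝓝 0) := tendsto_const_nhds.div_atTop tendsto_id
  have hbound : ∀ {μ : Measure Ω} [IsFiniteMeasure μ], MemLp f 2 μ → ∫ x, f x ^ 2 ∂μ ≤ M →
      ∀ {R : ℝ}, 0 < R → dist (∫ x, f x ∂μ) (∫ x, max (-R) (min R (f x)) ∂μ) ≤ M / R :=
    fun hfμ hμ R hR => (abs_integral_sub_integral_truncation_le hfμ hR).trans (by gcongr)
  refine TendstoUniformly.tendsto_of_eventually_tendsto (p := atTop (α := ℝ))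
    (F := fun R n => ∫ x, max (-R) (min R (f x)) ∂(P n : Measure Ω))
    (L := fun R => ∫ x, max (-R) (min R (f x)) ∂(ν : Measure Ω)) ?_ ?_ ?_
  · rw [Metric.tendstoUniformly_iff]
    intro ε hε
    filter_upwards [hMR.eventually_lt_const hε, eventually_gt_atTop 0] with R hRε hR n
    exact (hbound (hint n) (hM n) hR).trans_lt hRε
  · filter_upwards [eventually_ge_atTop 0] with R hR
    exact tendsto_integral_truncation hP hf hR
  · refine tendsto_of_tendsto_of_dist tendsto_const_nhds (squeeze_zero' ?_ ?_ hMR)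
    · exact .of_forall fun R => dist_nonneg
    · filter_upwards [eventually_gt_atTop 0] with R hR
      exact hbound hν.1 hν.2 hR

end WeakLimits

section MomentLimits

open Filter Topology

lemma HasMomentSeries.memLp_two_pow {μ : Measure ℝ} {F : ℝ⟦X⟧} (h : HasMomentSeries μ F) (n : ℕ) :
    MemLp (fun x => x ^ n) 2 μ := by
  rw [memLp_two_iff_integrable_sq (by fun_prop)]
  simpa only [← pow_mul] using (h (n * 2)).1

lemma HasMomentSeries.integral_pow_sq {μ : Measure ℝ} {F : ℝ⟦X⟧} (h : HasMomentSeries μ F)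
    (n : ℕ) : ∫ x, (x ^ n) ^ 2 ∂μ = coeff (n * 2) F := by
  simp only [← pow_mul, (h (n * 2)).2]

lemma HasMomentSeries.of_tendsto {P : ℕ → ProbabilityMeasure ℝ} {ν : ProbabilityMeasure ℝ}
    (hP : Tendsto P atTop (𝓝 ν)) {F : ℕ → ℝ⟦X⟧} {G : ℝ⟦X⟧}
    (hF : ∀ N, HasMomentSeries (P N) (F N))
    (hlim : ∀ n, Tendsto (fun N => coeff n (F N)) atTop (𝓝 (coeff n G))) :
    HasMomentSeries ν G := by
  intro n
  obtain ⟨M, hM⟩ := (hlim (n * 2)).bddAbove_range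
  have hsq : ∀ N, ∫ x, (x ^ n) ^ 2 ∂(P N : Measure ℝ) ≤ M := fun N =>
    ((hF N).integral_pow_sq n).trans_le (hM ⟨N, rfl⟩)
  have hpow : ∀ N, MemLp (fun x => x ^ n) 2 (P N : Measure ℝ) := fun N => (hF N).memLp_two_pow n
  refine ⟨(memLp_two_of_tendsto hP (continuous_pow n) hpow hsq).1.integrable one_le_two, ?_⟩
  refine tendsto_nhds_unique (hlim n) ?_
  simpa only [(hF _ n).2] using tendsto_integral_of_integral_sq_le hP (continuous_pow n) hpow hsq

lemma exists_tendsto_subseq_of_integral_sq_le {P : ℕ → ProbabilityMeasure ℝ} {M : ℝ}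
    (hint : ∀ N, Integrable (fun x => x ^ 2) (P N : Measure ℝ))
    (hM : ∀ N, ∫ x, x ^ 2 ∂(P N : Measure ℝ) ≤ M) :
    ∃ (ν : ProbabilityMeasure ℝ) (φ : ℕ → ℕ), StrictMono φ ∧ Tendsto (P ∘ φ) atTop (𝓝 ν) := by
  have hsq : ∀ x : ℝ, ‖x‖ₑ ^ 2 = ENNReal.ofReal (x ^ 2) := fun x => by
    rw [← enorm_pow, Real.enorm_of_nonneg (sq_nonneg x)]
  have htight : IsTightMeasureSet {μ : Measure ℝ | ∃ ρ ∈ Set.range P, (ρ : Measure ℝ) = μ} := by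
    refine isTightMeasureSet_of_lintegral_enorm_pow_le two_ne_zero ENNReal.ofReal_ne_top ?_
      (M := ENNReal.ofReal M)
    rintro _ ⟨_, ⟨N, rfl⟩, rfl⟩
    simp only [hsq]
    rw [← ofReal_integral_eq_lintegral_ofReal (hint N) (.of_forall fun x => sq_nonneg x)]
    exact ENNReal.ofReal_le_ofReal (hM N)
  obtain ⟨ν, -, φ, hφ, hν⟩ := (isCompact_closure_of_isTightMeasureSet htight).tendsto_subseq
    fun N => subset_closure (Set.mem_range_self N)
  exact ⟨ν, φ, hφ, hν⟩

lemma exists_hasMomentSeries_of_tendsto {P : ℕ → ProbabilityMeasure ℝ} {s : Set ℝ}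
    (hs : IsClosed s) (hPs : ∀ N, ∀ᵐ x ∂(P N : Measure ℝ), x ∈ s) {F : ℕ → ℝ⟦X⟧} {G : ℝ⟦X⟧}
    (hF : ∀ N, HasMomentSeries (P N) (F N))
    (hlim : ∀ n, Tendsto (fun N => coeff n (F N)) atTop (𝓝 (coeff n G))) :
    ∃ ν : ProbabilityMeasure ℝ, (∀ᵐ x ∂(ν : Measure ℝ), x ∈ s) ∧ HasMomentSeries ν G := by
  obtain ⟨M, hM⟩ := (hlim 2).bddAbove_range
  obtain ⟨ν, φ, hφ, hν⟩ := exists_tendsto_subseq_of_integral_sq_le (fun N => (hF N 2).1)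
    fun N => ((hF N 2).2.symm.trans_le (hM ⟨N, rfl⟩))
  exact ⟨ν, ae_mem_of_tendsto_of_isClosed hν hs fun N => hPs (φ N),
    .of_tendsto hν (fun N => hF (φ N)) fun n => (hlim n).comp hφ.tendsto_atTop⟩

lemma isStieltjesSeries_sFraction {β : ℕ → ℝ} (hβ : ∀ i, 0 ≤ β i) (i : ℕ) :
    IsStieltjesSeries 0 (sFraction β i) := by
  choose μ hμ0 hμ using fun N => (isGramSeries_sFracConvergent hβ N i).isStieltjesSeries
  have hprob : ∀ N, IsProbabilityMeasure (μ N) := fun N =>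
    isProbabilityMeasure_iff_real.2 <| by
      rw [(hμ N).measureReal_univ, constantCoeff_sFracConvergent]
  obtain ⟨ν, hν0, hν⟩ := exists_hasMomentSeries_of_tendsto (P := fun N => ⟨μ N, hprob N⟩)
    isClosed_Ici hμ0 hμ fun n => tendsto_const_nhds.congr' <| by
      filter_upwards [eventually_ge_atTop n] with N hN
      exact (coeff_sFracConvergent β hN i).symm
  exact ⟨ν, hν0, hν⟩

end MomentLimits

section FractionCoefficients

variable {ξ : ℝ} {g α β : ℕ → ℝ}

/-- Relations between `g` and `β` which, when `g 0 = 0`, hold for the coefficients `β` of the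
S-fraction obtained from one with coefficients `α`, where `XiCoefficients ξ g α`, by translating
the moments by `-ξ`. The value `β 0` plays no role. -/
def StieltjesCoefficients (ξ : ℝ) (g β : ℕ → ℝ) : Prop :=
  ∀ k, β (2 * k + 1) = g (2 * k + 1) ∧
    β (2 * k + 2) = (ξ * (1 + g (2 * k)) + g (2 * k + 1)) * g (2 * k + 2) / (1 + g (2 * k))

lemma exists_xiCoefficients (ξ : ℝ) (g : ℕ → ℝ) : ∃ α, XiCoefficients ξ g α :=
  ⟨fun n => if Odd n then ξ * (1 + g (n - 1)) + g n else g (n - 1) * g n / (1 + g (n - 2)),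
    fun k => by simp [Nat.odd_add]⟩

lemma exists_stieltjesCoefficients (hξ : 0 ≤ ξ) (hg : ∀ i, 0 ≤ g i) :
    ∃ β, (∀ i, 0 ≤ β i) ∧ StieltjesCoefficients ξ g β := by
  refine ⟨fun n => if Odd n then g n
    else (ξ * (1 + g (n - 2)) + g (n - 1)) * g n / (1 + g (n - 2)), fun n => ?_, fun k => ?_⟩
  · have h := hg n
    have h1 := hg (n - 1)
    have h2 := hg (n - 2)
    dsimp only
    split_ifs
    · exact h
    · positivity
  · simp [Nat.odd_add]

lemma XiCoefficients.contractionDiag_eq (hα : XiCoefficients ξ g α)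
    (hβ : StieltjesCoefficients ξ g β) (h0 : g 0 = 0) (hg : ∀ k, 1 + g (2 * k) ≠ 0) (j : ℕ) :
    contractionDiag α j = contractionDiag β j + ξ := by
  cases j with
  | zero =>
    have hα1 : α 1 = ξ * (1 + g 0) + g 1 := (hα 0).1
    have hβ1 : β 1 = g 1 := (hβ 0).1
    rw [contractionDiag, contractionDiag, hα1, hβ1, h0]
    ring
  | succ j =>
    have hα3 : α (2 * j + 3) = ξ * (1 + g (2 * j + 2)) + g (2 * j + 3) := (hα (j + 1)).1
    have hβ3 : β (2 * j + 3) = g (2 * j + 3) := (hβ (j + 1)).1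
    have hj := hg j
    rw [contractionDiag, contractionDiag, hα3, hβ3, (hα j).2, (hβ j).2]
    field_simp
    ring

lemma XiCoefficients.mul_eq (hα : XiCoefficients ξ g α) (hβ : StieltjesCoefficients ξ g β)
    (j : ℕ) : α (2 * j + 1) * α (2 * j + 2) = β (2 * j + 1) * β (2 * j + 2) := by
  rw [(hα j).1, (hα j).2, (hβ j).1, (hβ j).2]
  ring

lemma XiCoefficients.sFraction_eq (hα : XiCoefficients ξ g α)
    (hβ : StieltjesCoefficients ξ g β) (h0 : g 0 = 0) (hg : ∀ k, 1 + g (2 * k) ≠ 0) :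
    sFraction α 1 = binomialTransform ξ (sFraction β 1) := by
  have hαtails := (isFractionTails_sFraction α).contraction
  have hβtails := (isFractionTails_sFraction β).contraction.binomialTransform ξ
  simp only [← hα.contractionDiag_eq hβ h0 hg, ← hα.mul_eq hβ] at hβtails
  exact hαtails.eq hβtails 0

lemma exists_nonneg_even_odd {e o : ℕ → ℝ} (he : ∀ k, 0 ≤ e k) (ho : ∀ k, 0 ≤ o k) :
    ∃ g : ℕ → ℝ, (∀ i, 0 ≤ g i) ∧ (∀ k, g (2 * k) = e k) ∧ ∀ k, g (2 * k + 1) = o k := by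
  refine ⟨fun n => if Odd n then o (n / 2) else e (n / 2), fun n => ?_, fun k => ?_, fun k => ?_⟩
  · dsimp only
    split_ifs
    · exact ho _
    · exact he _
  · simp
  · simp [Nat.add_div]

/-- The even-indexed values `g (2 * k)` of the solution of `StieltjesCoefficients ξ g β` with
`g 0 = 0`. The quotient is `0` by convention when the fraction with coefficients `β` terminates. -/
noncomputable def evenSolutionOfStieltjes (ξ : ℝ) (β : ℕ → ℝ) : ℕ → ℝ
  | 0 => 0
  | k + 1 => β (2 * k + 2) * (1 + evenSolutionOfStieltjes ξ β k) /
      (ξ * (1 + evenSolutionOfStieltjes ξ β k) + β (2 * k + 1))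

lemma evenSolutionOfStieltjes_nonneg (hξ : 0 ≤ ξ) (hβ : ∀ i, 0 ≤ β i) (k : ℕ) :
    0 ≤ evenSolutionOfStieltjes ξ β k := by
  induction k with
  | zero => exact le_rfl
  | succ k ih =>
    have hodd := hβ (2 * k + 1)
    have heven := hβ (2 * k + 2)
    rw [evenSolutionOfStieltjes]
    positivity

lemma exists_stieltjesCoefficients_eq (hξ : 0 ≤ ξ) (hβ : ∀ i, 0 ≤ β i)
    (hzero : ∀ i, β i = 0 → β (i + 1) = 0) :
    ∃ g, g 0 = 0 ∧ (∀ i, 0 ≤ g i) ∧ StieltjesCoefficients ξ g β := by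
  have he := evenSolutionOfStieltjes_nonneg hξ hβ
  obtain ⟨g, hg, hgeven, hgodd⟩ := exists_nonneg_even_odd he fun k => hβ (2 * k + 1)
  refine ⟨g, hgeven 0, hg, fun k => ⟨(hgodd k).symm, ?_⟩⟩
  have hgnext : g (2 * k + 2) = _ := hgeven (k + 1)
  have hek : 0 < 1 + evenSolutionOfStieltjes ξ β k := by linarith [he k]
  rw [hgnext, hgeven, hgodd, evenSolutionOfStieltjes]
  rcases eq_or_ne (ξ * (1 + evenSolutionOfStieltjes ξ β k) + β (2 * k + 1)) 0 with h | h
  · have hodd : β (2 * k + 1) = 0 := by linarith [mul_nonneg hξ hek.le, hβ (2 * k + 1)]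
    rw [h, hzero _ hodd, zero_mul, zero_div]
  · field_simp

/-- The even-indexed values `g (2 * k)` of the solution of `XiCoefficients ξ g α` with `g 0 = 0`.
The quotient is `0` by convention when its denominator `g (2 * k + 1)` vanishes. -/
noncomputable def evenSolutionOfXi (ξ : ℝ) (α : ℕ → ℝ) : ℕ → ℝ
  | 0 => 0
  | k + 1 => α (2 * k + 2) * (1 + evenSolutionOfXi ξ α k) /
      (α (2 * k + 1) - ξ * (1 + evenSolutionOfXi ξ α k))

lemma XiCoefficients.odd_le (hα : XiCoefficients ξ g α) (hξ : 0 ≤ ξ) {k : ℕ} {e : ℝ}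
    (he : e ≤ g (2 * k)) : g (2 * k + 1) ≤ α (2 * k + 1) - ξ * (1 + e) := by
  rw [(hα k).1]
  linarith [mul_le_mul_of_nonneg_left he hξ]

lemma XiCoefficients.evenSolutionOfXi_mem_Icc (hα : XiCoefficients ξ g α) (hξ : 0 ≤ ξ)
    (hg : ∀ i, 0 ≤ g i) (k : ℕ) : evenSolutionOfXi ξ α k ∈ Set.Icc 0 (g (2 * k)) := by
  induction k with
  | zero => exact ⟨le_rfl, hg 0⟩
  | succ k ih =>
    have hodd := hα.odd_le hξ ih.2
    rw [evenSolutionOfXi]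
    set e := evenSolutionOfXi ξ α k
    set o := α (2 * k + 1) - ξ * (1 + e)
    have he : 0 ≤ e := ih.1
    have hg0 := hg (2 * k)
    have hg1 := hg (2 * k + 1)
    have hg2 := hg (2 * k + 2)
    have ho : 0 ≤ o := hg1.trans hodd
    rw [(hα k).2]
    refine ⟨by positivity, div_le_of_le_mul₀ ho hg2 ?_⟩
    calc g (2 * k + 1) * g (2 * k + 2) / (1 + g (2 * k)) * (1 + e)
        = g (2 * k + 1) * g (2 * k + 2) * ((1 + e) / (1 + g (2 * k))) := by ring
      _ ≤ o * g (2 * k + 2) * 1 := by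
        gcongr
        exact div_le_one_of_le₀ (by linarith [ih.2]) (by linarith)
      _ = g (2 * k + 2) * o := by ring

lemma XiCoefficients.exists_zero_start (hα : XiCoefficients ξ g α) (hξ : 0 ≤ ξ)
    (hg : ∀ i, 0 ≤ g i) :
    ∃ g', g' 0 = 0 ∧ (∀ i, 0 ≤ g' i) ∧ XiCoefficients ξ g' α := by
  have he := hα.evenSolutionOfXi_mem_Icc hξ hg
  have ho : ∀ k, g (2 * k + 1) ≤ α (2 * k + 1) - ξ * (1 + evenSolutionOfXi ξ α k) := fun k =>
    hα.odd_le hξ (he k).2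
  obtain ⟨g', hg', hgeven, hgodd⟩ :=
    exists_nonneg_even_odd (fun k => (he k).1) fun k => (hg _).trans (ho k)
  refine ⟨g', hgeven 0, hg', fun k => ⟨by rw [hgeven, hgodd]; ring, ?_⟩⟩
  have hgnext : g' (2 * k + 2) = _ := hgeven (k + 1)
  have hek : 1 + evenSolutionOfXi ξ α k ≠ 0 := by linarith [(he k).1]
  rw [hgnext, hgeven, hgodd, evenSolutionOfXi]
  rcases eq_or_ne (α (2 * k + 1) - ξ * (1 + evenSolutionOfXi ξ α k)) 0 with h | h
  · have hodd : g (2 * k + 1) = 0 := le_antisymm (h ▸ ho k) (hg _)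
    have hαzero : α (2 * k + 2) = 0 := by rw [(hα k).2, hodd, zero_mul, zero_div]
    rw [h, hαzero, zero_mul, zero_div]
  · field_simp

end FractionCoefficients

theorem theorem2 (ξ : ℝ) (hξ : 0 ≤ ξ) (a : ℕ → ℝ) :
    List.TFAE [
      IsXiStieltjes ξ a,
      ∃ (c : ℝ) (g α : ℕ → ℝ), 0 ≤ c ∧ g 0 = 0 ∧ (∀ i, 1 ≤ i → 0 ≤ g i) ∧
        XiCoefficients ξ g α ∧ IsSFraction (PowerSeries.mk a) c α,
      ∃ (c : ℝ) (g α : ℕ → ℝ), 0 ≤ c ∧ 0 ≤ g 0 ∧ (∀ i, 1 ≤ i → 0 ≤ g i) ∧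
        XiCoefficients ξ g α ∧ IsSFraction (PowerSeries.mk a) c α] := by
  have hpos : ∀ {g : ℕ → ℝ}, (∀ i, 0 ≤ g i) → ∀ k, 1 + g (2 * k) ≠ 0 := fun hg k =>
    (add_pos_of_pos_of_nonneg one_pos (hg _)).ne'
  rw [isXiStieltjes_iff, isStieltjesSeries_iff_exists]
  simp only [isSFraction_iff, ← smul_eq_C_mul]
  tfae_have 1 → 2 := by
    rintro ⟨_, hf, ha⟩
    obtain ⟨c, β, hc, hβ, hzero, rfl⟩ := hf.exists_sFraction
    obtain ⟨g, hg0, hg, hgβ⟩ := exists_stieltjesCoefficients_eq hξ hβ hzero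
    obtain ⟨α, hα⟩ := exists_xiCoefficients ξ g
    exact ⟨c, g, α, hc, hg0, fun i _ => hg i, hα, by
      rw [ha, map_smul, hα.sFraction_eq hgβ hg0 (hpos hg)]⟩
  tfae_have 2 → 3 := fun ⟨c, g, α, hc, hg0, h⟩ => ⟨c, g, α, hc, hg0.ge, h⟩
  tfae_have 3 → 1 := by
    rintro ⟨c, g', α, hc, hg0', hg', hα', ha⟩
    obtain ⟨g, hg0, hg, hα⟩ := hα'.exists_zero_start hξ (Nat.rec hg0' fun i _ => hg' _ i.succ_pos)
    obtain ⟨β, hβ, hgβ⟩ := exists_stieltjesCoefficients hξ hg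
    exact ⟨c • sFraction β 1, (isStieltjesSeries_sFraction hβ 1).smul hc, by
      rw [ha, map_smul, hα.sFraction_eq hgβ hg0 (hpos hg)]⟩
  tfae_finish
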